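/- Fix $0<r<1$. All Hilbert spaces are complex, and $B(H)$ denotes the bounded operators on $H$. Let $\mathbb{Q}\mathbb{A}_r$ be the collection of invertible Hilbert space operators $T$ with $\|T\|,\|T^{-1}\|\le r^{-1}$. Let $\mathscr{Q}\mathbb{A}_r$ be the collection of Hilbert space operators $J$ that, up to unitary equivalence, have the form $J=U\begin{pmatrix} rI_{K_{+1}}&0\\0&r^{-1}I_{K_{-1}}\end{pmatrix}$ on a Hilbert space direct sum $K_{+1}\oplus K_{-1}$ (either summand may be zero), where $U$ is unitary. An invertible $T\in B(H)$ dilates to an invertible $J\in B(K)$ if there is an isometry $V:H\to K$ with $T^n=V^*J^nV$ for all integers $n$; this dilation is trivial if the range of $V$ reduces $J$, that is, is invariant under $J$ and $J^*$. An element of $\mathbb{Q}\mathbb{A}_r$ is dilation extremal in $\mathbb{Q}\mathbb{A}_r$ if all of its dilations to elements of $\mathbb{Q}\mathbb{A}_r$ are trivial. Then: (a) If $J\in\mathscr{Q}\mathbb{A}_r$, then $J\in\mathbb{Q}\mathbb{A}_r$ and $J$ is dilation extremal in $\mathbb{Q}\mathbb{A}_r$. (b) If $J\in\mathscr{Q}\mathbb{A}_r$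 acts on $K$ and $\pi:B(K)\to B(E)$ is a unital $*$-representation on a Hilbert space $E$, then $\pi(J)\in\mathscr{Q}\mathbb{A}_r$. (c) Every $T\in\mathbb{Q}\mathbb{A}_r$ dilates to some $J\in\mathscr{Q}\mathbb{A}_r$. -/

import Mathlib

open ContinuousLinearMap

universe u v

/-- The block diagonal operator `a I ⊕ b I` on the Hilbert space direct sum `K₁ ⊕ K₂`
(the product space with its `ℓ²` norm). -/
noncomputable def blockScalar (K₁ K₂ : Type*)
    [NormedAddCommGroup K₁] [InnerProductSpace ℂ K₁]
    [NormedAddCommGroup K₂] [InnerProductSpace ℂ K₂] (a b : ℂ) :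
    WithLp 2 (K₁ × K₂) →L[ℂ] WithLp 2 (K₁ × K₂) :=
  (WithLp.prodContinuousLinearEquiv 2 ℂ K₁ K₂).symm.toContinuousLinearMap ∘L
    ((a • ContinuousLinearMap.id ℂ K₁).prodMap (b • ContinuousLinearMap.id ℂ K₂)) ∘L
    (WithLp.prodContinuousLinearEquiv 2 ℂ K₁ K₂).toContinuousLinearMap

theorem blockScalar_apply (K₁ K₂ : Type*)
    [NormedAddCommGroup K₁] [InnerProductSpace ℂ K₁]
    [NormedAddCommGroup K₂] [InnerProductSpace ℂ K₂] (a b : ℂ) (x : K₁) (y : K₂) :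
    blockScalar K₁ K₂ a b (WithLp.toLp 2 (x, y)) = WithLp.toLp 2 (a • x, b • y) := rfl

/-- Membership of the operator `T` on the Hilbert space `H` in the quantum annulus:
`T` is invertible and `‖T‖, ‖T⁻¹‖ ≤ r⁻¹`. -/
def QuantumAnnulus (r : ℝ) {H : Type*} [NormedAddCommGroup H] [InnerProductSpace ℂ H]
    (T : H →L[ℂ] H) : Prop :=
  ∃ t : (H →L[ℂ] H)ˣ, (t : H →L[ℂ] H) = T ∧
    ‖(t : H →L[ℂ] H)‖ ≤ r⁻¹ ∧ ‖((t⁻¹ : (H →L[ℂ] H)ˣ) : H →L[ℂ] H)‖ ≤ r⁻¹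

/-- The operators `J` on `H` that, up to unitary equivalence `W`, have the form
`U (r I ⊕ r⁻¹ I)` on a Hilbert space direct sum `K₁ ⊕ K₂`, with `U` unitary. The summands may
be zero. Taking them in the universe of `H` is no restriction, as they embed in `H`. -/
def QABoundary (r : ℝ) {H : Type u} [NormedAddCommGroup H] [InnerProductSpace ℂ H]
    (J : H →L[ℂ] H) : Prop :=
  ∃ (K₁ : Type u) (_ : NormedAddCommGroup K₁) (_ : InnerProductSpace ℂ K₁)
    (_ : CompleteSpace K₁)
    (K₂ : Type u) (_ : NormedAddCommGroup K₂) (_ : InnerProductSpace ℂ K₂)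
    (_ : CompleteSpace K₂)
    (W : H ≃ₗᵢ[ℂ] WithLp 2 (K₁ × K₂))
    (U : WithLp 2 (K₁ × K₂) →L[ℂ] WithLp 2 (K₁ × K₂)),
    U ∈ unitary (WithLp 2 (K₁ × K₂) →L[ℂ] WithLp 2 (K₁ × K₂)) ∧
    ∀ x : H, J x = W.symm (U (blockScalar K₁ K₂ (r : ℂ) ((r⁻¹ : ℝ) : ℂ) (W x)))

/-- The isometry `V : H → K` implements a `ℂ[x, x⁻¹]`-dilation of the invertible operator `T`
to the invertible operator `J`: `Tⁿ = V* Jⁿ V` for all integers `n`. -/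
def DilatesVia {H K : Type*}
    [NormedAddCommGroup H] [InnerProductSpace ℂ H] [CompleteSpace H]
    [NormedAddCommGroup K] [InnerProductSpace ℂ K] [CompleteSpace K]
    (T : H →L[ℂ] H) (J : K →L[ℂ] K) (V : H →ₗᵢ[ℂ] K) : Prop :=
  ∃ (t : (H →L[ℂ] H)ˣ) (j : (K →L[ℂ] K)ˣ),
    (t : H →L[ℂ] H) = T ∧ (j : K →L[ℂ] K) = J ∧
    ∀ n : ℤ, ((t ^ n : (H →L[ℂ] H)ˣ) : H →L[ℂ] H) =
      adjoint V.toContinuousLinearMap ∘L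
        ((j ^ n : (K →L[ℂ] K)ˣ) : K →L[ℂ] K) ∘L V.toContinuousLinearMap

/-- The subspace `M` reduces `F`: it is invariant under `F` and `F*`. -/
def Reduces {K : Type*} [NormedAddCommGroup K] [InnerProductSpace ℂ K] [CompleteSpace K]
    (M : Submodule ℂ K) (F : K →L[ℂ] K) : Prop :=
  (∀ x ∈ M, F x ∈ M) ∧ (∀ x ∈ M, adjoint F x ∈ M)

/-- `J` belongs to the quantum annulus and each of its dilations to a member `F` of the quantum
annulus is trivial: the range of the isometry reduces `F`. The dilation space ranges over all
Hilbert spaces in the universe `v`. -/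
def DilationExtremal (r : ℝ) {H : Type u}
    [NormedAddCommGroup H] [InnerProductSpace ℂ H] [CompleteSpace H] (J : H →L[ℂ] H) : Prop :=
  QuantumAnnulus r J ∧
  ∀ (K : Type v) [NormedAddCommGroup K] [InnerProductSpace ℂ K] [CompleteSpace K]
    (F : K →L[ℂ] K) (V : H →ₗᵢ[ℂ] K),
    QuantumAnnulus r F → DilatesVia J F V → Reduces V.toLinearMap.range F

/-!
Write `c = r² + r⁻²`. Everything rests on an algebraic description of the two classes in terms of
`T*T + T⁻¹T⁻¹*`. If `‖T‖, ‖T⁻¹‖ ≤ r⁻¹`, then `r⁻² - T*T` and `r⁻² - (T*T)⁻¹` are commuting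
positive operators, and positivity of their product says `T*T + T⁻¹T⁻¹* ≤ c`
(`star_mul_self_add_inv_le`). Equality holds, `J*J + J⁻¹J⁻¹* = c`, precisely for the operators
`J = U (r I ⊕ r⁻¹ I)` (`QABoundary.exists_isExtremalUnit`, `IsExtremalUnit.qaBoundary`): the
identity is a quadratic equation for `J*J` with roots `r²` and `r⁻²`, so the space is the direct
sum of the two eigenspaces of `J*J`.

*Extremality.* Suppose that `J` satisfies the equality and dilates via `V` to `F` in the quantum
annulus. From `J = V*FV` and `J⁻¹* = V*F⁻¹*V` one gets
`c‖x‖² = ‖Jx‖² + ‖J⁻¹*x‖² ≤ ‖FVx‖² + ‖F⁻¹*Vx‖² ≤ c‖x‖²`, so that `V*` preserves the norms of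
`FVx` and `F⁻¹*Vx`. These vectors therefore lie in the range of `V` (`IsExtremalUnit.reduces`).

*Representations.* A unital `*`-homomorphism preserves the equality.

*Dilation.* Given `T` in the quantum annulus, let `B` be the positive square root of
`c - TT* - (TT*)⁻¹`. It commutes with `TT*`, and because of this the operator matrix
`J = [[T, B], [0, T⁻¹]]` on `H ⊕ H` satisfies the equality (`isExtremalUnit_dilationUnit`). As
`H ⊕ 0` is invariant under `J` and `J⁻¹`, which restrict there to `T` and `T⁻¹`, the operator `J`
dilates `T`.
-/

/-! ### The defining inequality and its extreme case -/

section CStarAlgebra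

variable {A : Type*} [CStarAlgebra A]

/-- The extreme case `j*j + j⁻¹j⁻¹* = r² + r⁻²` of the inequality that holds for all members of the
quantum annulus. The constant is a complex number since `*`-homomorphisms are complex linear. -/
def IsExtremalUnit (r : ℝ) (j : Aˣ) : Prop :=
  star (j : A) * j + (↑j⁻¹ : A) * star (↑j⁻¹ : A) = ((r ^ 2 + r⁻¹ ^ 2 : ℝ) : ℂ) • (1 : A)

theorem star_mul_self_mul_inv_mul_star (t : Aˣ) :
    star (t : A) * t * ((↑t⁻¹ : A) * star (↑t⁻¹ : A)) = 1 := by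
  rw [mul_assoc, t.mul_inv_cancel_left, ← star_mul, t.inv_mul, star_one]

theorem inv_mul_star_mul_star_mul_self (t : Aˣ) :
    (↑t⁻¹ : A) * star (↑t⁻¹ : A) * (star (t : A) * t) = 1 := by
  rw [mul_assoc, ← mul_assoc (star _) (star _), ← star_mul, t.mul_inv, star_one, one_mul,
    t.inv_mul]

theorem star_mul_self_add_inv_le [PartialOrder A] [StarOrderedRing A] {r : ℝ} (hr : 0 < r)
    (t : Aˣ) (h1 : ‖(t : A)‖ ≤ r⁻¹) (h2 : ‖(↑t⁻¹ : A)‖ ≤ r⁻¹) :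
    star (t : A) * t + (↑t⁻¹ : A) * star (↑t⁻¹ : A) ≤ ((r ^ 2 + r⁻¹ ^ 2 : ℝ) : ℂ) • (1 : A) := by
  have key (b : A) (hb : ‖b‖ ≤ r⁻¹) : star b * b ≤ (r⁻¹ ^ 2) • (1 : A) := by
    refine CStarAlgebra.star_mul_le_algebraMap_norm_sq.trans ?_
    rw [Algebra.algebraMap_eq_smul_one]
    exact smul_le_smul_of_nonneg_right (by gcongr) zero_le_one
  have hX := key t h1
  have hY := key (star (↑t⁻¹ : A)) (by rwa [norm_star])
  rw [star_star] at hY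
  have hXY := star_mul_self_mul_inv_mul_star t
  have hYX := inv_mul_star_mul_star_mul_self t
  generalize star (t : A) * t = X at *
  generalize (↑t⁻¹ : A) * star (↑t⁻¹ : A) = Y at *
  have hcomm : Commute ((r⁻¹ ^ 2) • (1 : A) - X) ((r⁻¹ ^ 2) • (1 : A) - Y) := by
    have hXY' : Commute X Y := hXY.trans hYX.symm
    exact (((Commute.one_left _).smul_left _).sub_left
      (((Commute.one_right _).smul_right _).sub_right hXY'))
  have hpos := smul_nonneg (sq_nonneg r)
    (hcomm.mul_nonneg (sub_nonneg.2 hX) (sub_nonneg.2 hY))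
  -- the product is `r⁻² (c - X - Y)`, as `X Y = 1`
  rw [Complex.coe_smul, ← sub_nonneg]
  convert hpos using 1
  have e : r ^ 2 * r⁻¹ ^ 2 = 1 := by field_simp
  simp only [sub_mul, mul_sub, hXY, smul_mul_assoc, mul_smul_comm, one_mul, mul_one, smul_sub,
    smul_smul, add_smul, ← mul_assoc, e, one_smul]
  abel

theorem IsExtremalUnit.map {B : Type*} [CStarAlgebra B] {r : ℝ} {j : Aˣ}
    (hj : IsExtremalUnit r j) (π : A →⋆ₐ[ℂ] B) :
    IsExtremalUnit r (Units.map (π : A →* B) j) := by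
  have := congrArg π hj
  simp only [map_add, map_mul, map_star, map_smul, map_one] at this
  exact this

/-- For `d = r I ⊕ r⁻¹ I` and `d' = d⁻¹`, the element `u * d` is the operator `U (r I ⊕ r⁻¹ I)`. -/
theorem exists_isExtremalUnit_unitary_mul {r : ℝ} {u d d' : A} (hu : u ∈ unitary A)
    (hdd' : d * d' = 1) (hd'd : d' * d = 1) (hd : star d = d) (hd' : star d' = d')
    (hsum : d * d + d' * d' = ((r ^ 2 + r⁻¹ ^ 2 : ℝ) : ℂ) • (1 : A))
    (hnd : ‖d‖ ≤ r⁻¹) (hnd' : ‖d'‖ ≤ r⁻¹) :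
    ∃ j : Aˣ, (j : A) = u * d ∧ ‖(j : A)‖ ≤ r⁻¹ ∧ ‖(↑j⁻¹ : A)‖ ≤ r⁻¹ ∧ IsExtremalUnit r j := by
  obtain ⟨hu₁, hu₂⟩ := Unitary.mem_iff.1 hu
  refine ⟨⟨u * d, d' * star u, ?_, ?_⟩, rfl, ?_, ?_, ?_⟩
  · rw [mul_assoc, ← mul_assoc d, hdd', one_mul, hu₂]
  · rw [mul_assoc, ← mul_assoc (star u), hu₁, one_mul, hd'd]
  · rwa [Units.val_mk, CStarRing.norm_mem_unitary_mul _ hu]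
  · rwa [Units.inv_mk, Units.val_mk, CStarRing.norm_mul_mem_unitary _ (Unitary.star_mem hu)]
  · rw [IsExtremalUnit, Units.inv_mk, Units.val_mk, Units.val_mk, star_mul, star_mul, star_star,
      hd, hd', mul_assoc, ← mul_assoc (star u), hu₁, one_mul, mul_assoc, ← mul_assoc (star u),
      hu₁, one_mul, hsum]

/-- An invertible `j` with `j*j = d²`, where `d` is invertible with self-adjoint inverse `d'`,
differs from `d` by a unitary. -/
theorem mul_inv_mem_unitary {j : Aˣ} {d d' : A} (hdd' : d * d' = 1) (hd'd : d' * d = 1)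
    (hd' : star d' = d') (h : star (j : A) * j = d * d) : (j : A) * d' ∈ unitary A := by
  have h1 : star ((j : A) * d') * (j * d') = 1 := by
    rw [star_mul, hd', mul_assoc, ← mul_assoc (star _), h, mul_assoc d, hdd', mul_one, hd'd]
  -- a left inverse of an invertible element is a right inverse
  have h2 : (j : A) * d' * (d * (↑j⁻¹ : A)) = 1 := by
    rw [mul_assoc, ← mul_assoc d', hd'd, one_mul, j.mul_inv]
  refine Unitary.mem_iff.2 ⟨h1, ?_⟩
  rw [left_inv_eq_right_inv h1 h2, h2]

end CStarAlgebra

/-! ### Block diagonal scalar operators -/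

section BlockScalar

variable {H K : Type*} [NormedAddCommGroup H] [InnerProductSpace ℂ H]
  [NormedAddCommGroup K] [InnerProductSpace ℂ K]

theorem blockScalar_mul (a b c d : ℂ) :
    blockScalar H K a b * blockScalar H K c d = blockScalar H K (a * c) (b * d) := by
  refine ContinuousLinearMap.ext fun x => ?_
  obtain ⟨x, y⟩ := x
  simp only [mul_apply_eq_comp, blockScalar_apply, smul_smul]

theorem blockScalar_self (a : ℂ) : blockScalar H K a a = a • 1 :=
  rfl

theorem blockScalar_one : blockScalar H K 1 1 = 1 := by
  refine ContinuousLinearMap.ext fun x => ?_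
  obtain ⟨x, y⟩ := x
  rw [blockScalar_apply, one_smul, one_smul, one_apply_eq_self]

theorem blockScalar_mul_of_inv {a b : ℂ} (hab : a * b = 1) :
    blockScalar H K a b * blockScalar H K b a = 1 := by
  rw [blockScalar_mul, hab, mul_comm b, hab, blockScalar_one]

theorem blockScalar_add (a b c d : ℂ) :
    blockScalar H K a b + blockScalar H K c d = blockScalar H K (a + c) (b + d) := by
  refine ContinuousLinearMap.ext fun x => ?_
  obtain ⟨x, y⟩ := x
  simp only [add_apply, blockScalar_apply, add_smul, ← WithLp.toLp_add, Prod.mk_add_mk]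

theorem norm_blockScalar_le (a b : ℂ) {M : ℝ} (ha : ‖a‖ ≤ M) (hb : ‖b‖ ≤ M) :
    ‖blockScalar H K a b‖ ≤ M := by
  have hM : 0 ≤ M := (norm_nonneg a).trans ha
  refine opNorm_le_bound _ hM fun x => ?_
  rw [← sq_le_sq₀ (norm_nonneg _) (by positivity), mul_pow, WithLp.prod_norm_sq_eq_of_L2,
    WithLp.prod_norm_sq_eq_of_L2]
  simp only [blockScalar, coe_comp, Function.comp_apply, ContinuousLinearEquiv.coe_coe]
  simp [norm_smul, mul_pow, mul_add]
  gcongr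

theorem star_blockScalar [CompleteSpace H] [CompleteSpace K] (a b : ℂ) :
    star (blockScalar H K a b) = blockScalar H K (star a) (star b) := by
  rw [star_eq_adjoint, eq_comm, eq_adjoint_iff]
  intro x y
  simp [blockScalar, WithLp.prod_inner_apply, inner_smul_left, inner_smul_right]

end BlockScalar

/-! ### The operators `U (r I ⊕ r⁻¹ I)` are the extreme case -/

section Characterization

variable {H : Type u} [NormedAddCommGroup H] [InnerProductSpace ℂ H] [CompleteSpace H]

/-- The version of `exists_isExtremalUnit_unitary_mul` up to unitary equivalence. -/
theorem exists_isExtremalUnit_conj {L : Type*} [NormedAddCommGroup L] [InnerProductSpace ℂ L]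
    [CompleteSpace L] {r : ℝ} (W : H ≃ₗᵢ[ℂ] L) {u d d' : L →L[ℂ] L} (hu : u ∈ unitary (L →L[ℂ] L))
    (hdd' : d * d' = 1) (hd'd : d' * d = 1) (hd : star d = d) (hd' : star d' = d')
    (hsum : d * d + d' * d' = ((r ^ 2 + r⁻¹ ^ 2 : ℝ) : ℂ) • (1 : L →L[ℂ] L))
    (hnd : ‖d‖ ≤ r⁻¹) (hnd' : ‖d'‖ ≤ r⁻¹) :
    ∃ j : (H →L[ℂ] H)ˣ, (∀ x, (j : H →L[ℂ] H) x = W.symm (u (d (W x)))) ∧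
      ‖(j : H →L[ℂ] H)‖ ≤ r⁻¹ ∧ ‖(↑j⁻¹ : H →L[ℂ] H)‖ ≤ r⁻¹ ∧ IsExtremalUnit r j := by
  obtain ⟨j, hj, h1, h2, hext⟩ :=
    exists_isExtremalUnit_unitary_mul hu hdd' hd'd hd hd' hsum hnd hnd'
  let Φ : (L →L[ℂ] L) →⋆ₐ[ℂ] (H →L[ℂ] H) := W.symm.conjStarAlgEquiv.toStarAlgHom
  refine ⟨Units.map (Φ : (L →L[ℂ] L) →* (H →L[ℂ] H)) j, fun x => ?_,
    (NonUnitalStarAlgHom.norm_apply_le Φ _).trans h1,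
    (NonUnitalStarAlgHom.norm_apply_le Φ _).trans h2, hext.map Φ⟩
  change W.symm ((j : L →L[ℂ] L) (W x)) = _
  rw [hj, mul_apply_eq_comp]

/-- The version of `mul_inv_mem_unitary` up to unitary equivalence. -/
theorem exists_mem_unitary_conj {L : Type*} [NormedAddCommGroup L] [InnerProductSpace ℂ L]
    [CompleteSpace L] (W : H ≃ₗᵢ[ℂ] L) (j : (H →L[ℂ] H)ˣ) {d d' : L →L[ℂ] L}
    (hdd' : d * d' = 1) (hd'd : d' * d = 1) (hd' : star d' = d')
    (h : ∀ x, (star (j : H →L[ℂ] H) * j) (W.symm x) = W.symm (d (d x))) :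
    ∃ u ∈ unitary (L →L[ℂ] L), ∀ x, (j : H →L[ℂ] H) x = W.symm (u (d (W x))) := by
  let Φ : (H →L[ℂ] H) →⋆ₐ[ℂ] (L →L[ℂ] L) := W.conjStarAlgEquiv.toStarAlgHom
  let j' := Units.map (Φ : (H →L[ℂ] H) →* (L →L[ℂ] L)) j
  have hj' : star (j' : L →L[ℂ] L) * j' = d * d := by
    have h' : star (Φ j) * Φ j = Φ (star (j : H →L[ℂ] H) * j) := by rw [map_mul, map_star]
    refine h'.trans (ContinuousLinearMap.ext fun x => ?_)
    change W ((star (j : H →L[ℂ] H) * j) (W.symm x)) = d (d x)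
    rw [h, W.apply_symm_apply]
  refine ⟨j' * d', mul_inv_mem_unitary hdd' hd'd hd' hj', fun x => ?_⟩
  rw [← mul_apply_eq_comp, mul_assoc, hd'd, mul_one]
  change _ = W.symm (W ((j : H →L[ℂ] H) (W.symm (W x))))
  rw [W.symm_apply_apply, W.symm_apply_apply]

theorem QABoundary.exists_isExtremalUnit {r : ℝ} (hr0 : 0 < r) (hr1 : r ≤ 1) {J : H →L[ℂ] H}
    (hJ : QABoundary r J) :
    ∃ j : (H →L[ℂ] H)ˣ, (j : H →L[ℂ] H) = J ∧ ‖(j : H →L[ℂ] H)‖ ≤ r⁻¹ ∧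
      ‖(↑j⁻¹ : H →L[ℂ] H)‖ ≤ r⁻¹ ∧ IsExtremalUnit r j := by
  obtain ⟨K₁, _, _, _, K₂, _, _, _, W, U, hU, hJ⟩ := hJ
  have hr : (r : ℂ) * ((r⁻¹ : ℝ) : ℂ) = 1 := by exact_mod_cast mul_inv_cancel₀ hr0.ne'
  have hinv : r ≤ r⁻¹ := hr1.trans ((one_le_inv₀ hr0).2 hr1)
  have hsum : blockScalar K₁ K₂ (r : ℂ) ((r⁻¹ : ℝ) : ℂ) * blockScalar K₁ K₂ r ((r⁻¹ : ℝ) : ℂ) +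
      blockScalar K₁ K₂ ((r⁻¹ : ℝ) : ℂ) r * blockScalar K₁ K₂ ((r⁻¹ : ℝ) : ℂ) r =
        ((r ^ 2 + r⁻¹ ^ 2 : ℝ) : ℂ) • 1 := by
    rw [blockScalar_mul, blockScalar_mul, blockScalar_add, ← blockScalar_self]
    congr 1 <;> push_cast <;> ring
  obtain ⟨j, hj, h⟩ := exists_isExtremalUnit_conj W hU
    (blockScalar_mul_of_inv hr) (blockScalar_mul_of_inv ((mul_comm _ _).trans hr))
    (by rw [star_blockScalar]; simp) (by rw [star_blockScalar]; simp) hsum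
    (norm_blockScalar_le _ _ (by simpa [abs_of_pos hr0]) (by simp [abs_of_pos hr0]))
    (norm_blockScalar_le _ _ (by simp [abs_of_pos hr0]) (by simpa [abs_of_pos hr0]))
  exact ⟨j, ContinuousLinearMap.ext fun x => (hj x).trans (hJ x).symm, h⟩

/-- The space splits into the eigenspaces of `j*j` for `r²` and `r⁻²`, and `j` differs by a unitary
from the operator that is `r` on the first and `r⁻¹` on the second. -/
theorem IsExtremalUnit.qaBoundary {r : ℝ} (hr0 : 0 < r) {j : (H →L[ℂ] H)ˣ}
    (hj : IsExtremalUnit r j) : QABoundary r (j : H →L[ℂ] H) := by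
  have hr : (r : ℂ) ≠ 0 := by exact_mod_cast hr0.ne'
  have hXY := star_mul_self_mul_inv_mul_star j
  rw [IsExtremalUnit] at hj
  set X : H →L[ℂ] H := star (j : H →L[ℂ] H) * j with hX
  have hsX : star X = X := by simp [hX]
  have hquad (x : H) : X (X x) + x = ((r : ℂ) ^ 2 + (r : ℂ)⁻¹ ^ 2) • X x := by
    have := congrArg (fun A : H →L[ℂ] H => (X * A) x) hj
    simpa [mul_add, hXY] using this
  let M : Submodule ℂ H := (X - ((r : ℂ) ^ 2) • (1 : H →L[ℂ] H)).ker
  have hmem (x : H) : x ∈ M ↔ X x = ((r : ℂ) ^ 2) • x := by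
    simp [M, sub_eq_zero]
  have : CompleteSpace M := (ContinuousLinearMap.isClosed_ker _).completeSpace_coe
  -- on `Mᗮ`, the vector `(X - r⁻²) x` lies in `M` by the quadratic equation and in `Mᗮ` since `M`
  -- reduces `X`
  have hMX (x : H) (hx : x ∈ Mᗮ) : X x = ((r : ℂ)⁻¹ ^ 2) • x := by
    rw [← sub_eq_zero, ← Submodule.mem_bot ℂ, ← M.inf_orthogonal_eq_bot]
    refine ⟨(hmem _).2 ?_, ?_⟩
    · rw [map_sub, map_smul, eq_sub_of_add_eq (hquad x), smul_sub, smul_smul, ← mul_pow,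
        mul_inv_cancel₀ hr, add_smul, one_pow, one_smul]
      abel
    · refine sub_mem (fun y hy => ?_) (Submodule.smul_mem _ _ hx)
      have : inner ℂ y (X x) = inner ℂ (X y) x := by
        conv_lhs => rw [← hsX]
        rw [star_eq_adjoint, adjoint_inner_right]
      rw [this, (hmem y).1 hy, inner_smul_left, hx y hy, mul_zero]
  have hr' : (r : ℂ) * ((r⁻¹ : ℝ) : ℂ) = 1 := by exact_mod_cast mul_inv_cancel₀ hr0.ne'
  obtain ⟨U, hU, hJ⟩ := exists_mem_unitary_conj M.orthogonalDecomposition j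
    (blockScalar_mul_of_inv (H := M) (K := Mᗮ) hr')
    (blockScalar_mul_of_inv ((mul_comm _ _).trans hr')) (by rw [star_blockScalar]; simp)
    (by
      rintro ⟨a, b⟩
      rw [blockScalar_apply, blockScalar_apply, ← hX]
      simp only [Submodule.orthogonalDecomposition_symm_apply]
      simp [(hmem a).1 a.2, hMX b b.2, pow_two, mul_smul])
  exact ⟨M, inferInstance, inferInstance, inferInstance, (Mᗮ : Submodule ℂ H), inferInstance,
    inferInstance, inferInstance, M.orthogonalDecomposition, U, hU, hJ⟩

end Characterization

/-! ### Extremality -/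

section Extremality

variable {H K : Type*} [NormedAddCommGroup H] [InnerProductSpace ℂ H] [CompleteSpace H]
  [NormedAddCommGroup K] [InnerProductSpace ℂ K] [CompleteSpace K]

theorem LinearIsometry.norm_adjoint_apply_le (V : H →ₗᵢ[ℂ] K) (y : K) :
    ‖adjoint V.toContinuousLinearMap y‖ ≤ ‖y‖ := by
  refine (le_opNorm _ _).trans ?_
  rw [LinearIsometryEquiv.norm_map]
  exact mul_le_of_le_one_left (norm_nonneg _) V.norm_toContinuousLinearMap_le

/-- A vector whose norm is not decreased by `V*` lies in the range of the isometry `V`. -/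
theorem LinearIsometry.apply_adjoint_apply_of_norm_le (V : H →ₗᵢ[ℂ] K) {y : K}
    (h : ‖y‖ ≤ ‖adjoint V.toContinuousLinearMap y‖) :
    V (adjoint V.toContinuousLinearMap y) = y := by
  set z := adjoint V.toContinuousLinearMap y with hz
  have h1 : inner ℂ (V z) y = ((‖z‖ ^ 2 : ℝ) : ℂ) := by
    have := adjoint_inner_right V.toContinuousLinearMap z y
    rw [LinearIsometry.coe_toContinuousLinearMap] at this
    rw [← this, ← hz, inner_self_eq_norm_sq_to_K]
    simp
  have h2 := norm_sub_sq (𝕜 := ℂ) (V z) y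
  have h3 : RCLike.re ((‖z‖ ^ 2 : ℝ) : ℂ) = ‖z‖ ^ 2 := Complex.ofReal_re _
  rw [h1, V.norm_map, h3] at h2
  have h4 : ‖y‖ ^ 2 ≤ ‖z‖ ^ 2 := by gcongr
  rw [← sub_eq_zero, ← norm_eq_zero, ← sq_eq_zero_iff]
  nlinarith [sq_nonneg ‖V z - y‖]

theorem re_inner_star_mul_self_add_inv (t : (H →L[ℂ] H)ˣ) (x : H) :
    RCLike.re (inner ℂ ((star (t : H →L[ℂ] H) * t +
        (↑t⁻¹ : H →L[ℂ] H) * star (↑t⁻¹ : H →L[ℂ] H)) x) x) =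
      ‖(t : H →L[ℂ] H) x‖ ^ 2 + ‖adjoint (↑t⁻¹ : H →L[ℂ] H) x‖ ^ 2 := by
  simp only [star_eq_adjoint, add_apply, mul_apply_eq_comp, inner_add_left, map_add]
  rw [← adjoint_inner_right (↑t⁻¹ : H →L[ℂ] H), adjoint_inner_left, ← norm_sq_eq_re_inner,
    ← norm_sq_eq_re_inner]

theorem re_inner_ofReal_smul_one {E : Type*} [NormedAddCommGroup E] [InnerProductSpace ℂ E]
    (c : ℝ) (x : E) : RCLike.re (inner ℂ (((c : ℂ) • (1 : E →L[ℂ] E)) x) x) = c * ‖x‖ ^ 2 := by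
  rw [smul_apply, one_apply_eq_self, inner_smul_left, Complex.conj_ofReal,
    norm_sq_eq_re_inner (𝕜 := ℂ)]
  exact Complex.re_ofReal_mul c _

/-- The form of `star_mul_self_add_inv_le` on vectors. -/
theorem norm_sq_add_norm_sq_le {r : ℝ} (hr0 : 0 < r) (t : (H →L[ℂ] H)ˣ)
    (h1 : ‖(t : H →L[ℂ] H)‖ ≤ r⁻¹) (h2 : ‖(↑t⁻¹ : H →L[ℂ] H)‖ ≤ r⁻¹) (x : H) :
    ‖(t : H →L[ℂ] H) x‖ ^ 2 + ‖adjoint (↑t⁻¹ : H →L[ℂ] H) x‖ ^ 2 ≤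
      (r ^ 2 + r⁻¹ ^ 2) * ‖x‖ ^ 2 := by
  have h := ((ContinuousLinearMap.le_def _ _).1
    (star_mul_self_add_inv_le hr0 t h1 h2)).re_inner_nonneg_left x
  rw [sub_apply, inner_sub_left, map_sub, re_inner_star_mul_self_add_inv,
    re_inner_ofReal_smul_one] at h
  linarith

theorem IsExtremalUnit.norm_sq_add_norm_sq {r : ℝ} {j : (H →L[ℂ] H)ˣ}
    (hj : IsExtremalUnit r j) (x : H) :
    ‖(j : H →L[ℂ] H) x‖ ^ 2 + ‖adjoint (↑j⁻¹ : H →L[ℂ] H) x‖ ^ 2 =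
      (r ^ 2 + r⁻¹ ^ 2) * ‖x‖ ^ 2 := by
  rw [← re_inner_star_mul_self_add_inv, hj, re_inner_ofReal_smul_one]

theorem IsExtremalUnit.reduces {r : ℝ} (hr0 : 0 < r) {j : (H →L[ℂ] H)ˣ}
    (hj : IsExtremalUnit r j) {F : K →L[ℂ] K} {V : H →ₗᵢ[ℂ] K} (hF : QuantumAnnulus r F)
    (hV : DilatesVia (j : H →L[ℂ] H) F V) : Reduces V.toLinearMap.range F := by
  obtain ⟨f, rfl, hf1, hf2⟩ := hF
  obtain ⟨j', f', hjj', hff', hpow⟩ := hV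
  obtain rfl := Units.ext hjj'
  obtain rfl := Units.ext hff'
  have p1 (x : H) : (j' : H →L[ℂ] H) x =
      adjoint V.toContinuousLinearMap ((f' : K →L[ℂ] K) (V x)) := by
    simpa using congrArg (fun A : H →L[ℂ] H => A x) (hpow 1)
  have p2 (x : H) : adjoint (↑j'⁻¹ : H →L[ℂ] H) x =
      adjoint V.toContinuousLinearMap (adjoint (↑f'⁻¹ : K →L[ℂ] K) (V x)) := by
    have := congrArg (fun A : H →L[ℂ] H => adjoint A x) (hpow (-1))
    simpa [adjoint_comp] using this
  have key (x : H) : (f' : K →L[ℂ] K) (V x) = V ((j' : H →L[ℂ] H) x) ∧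
      adjoint (↑f'⁻¹ : K →L[ℂ] K) (V x) = V (adjoint (↑j'⁻¹ : H →L[ℂ] H) x) := by
    have h1 := norm_sq_add_norm_sq_le hr0 f' hf1 hf2 (V x)
    rw [V.norm_map, ← hj.norm_sq_add_norm_sq x, p1, p2] at h1
    have h2 := pow_le_pow_left₀ (norm_nonneg _)
      (V.norm_adjoint_apply_le ((f' : K →L[ℂ] K) (V x))) 2
    have h3 := pow_le_pow_left₀ (norm_nonneg _)
      (V.norm_adjoint_apply_le (adjoint (↑f'⁻¹ : K →L[ℂ] K) (V x))) 2
    rw [p1, p2]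
    exact ⟨(V.apply_adjoint_apply_of_norm_le
        ((sq_le_sq₀ (norm_nonneg _) (norm_nonneg _)).1 (by linarith))).symm,
      (V.apply_adjoint_apply_of_norm_le
        ((sq_le_sq₀ (norm_nonneg _) (norm_nonneg _)).1 (by linarith))).symm⟩
  have hf : adjoint (f' : K →L[ℂ] K) * adjoint (↑f'⁻¹ : K →L[ℂ] K) = 1 := by
    rw [← star_eq_adjoint, ← star_eq_adjoint, ← star_mul, f'.inv_mul, star_one]
  have hj' : adjoint (↑j'⁻¹ : H →L[ℂ] H) * adjoint (j' : H →L[ℂ] H) = 1 := by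
    rw [← star_eq_adjoint, ← star_eq_adjoint, ← star_mul, j'.mul_inv, star_one]
  constructor
  · rintro _ ⟨x, rfl⟩
    exact ⟨_, (key x).1.symm⟩
  · rintro _ ⟨x, rfl⟩
    -- apply `F*` to `F⁻¹* V y = V J⁻¹* y` with `y = J* x`
    refine ⟨adjoint (j' : H →L[ℂ] H) x, ?_⟩
    have h := congrArg (adjoint (f' : K →L[ℂ] K)) (key (adjoint (j' : H →L[ℂ] H) x)).2
    have e1 := congrArg (fun A : K →L[ℂ] K => A (V (adjoint (j' : H →L[ℂ] H) x))) hf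
    have e2 := congrArg (fun A : H →L[ℂ] H => A x) hj'
    simp only [mul_apply_eq_comp, one_apply_eq_self] at e1 e2
    rw [e1, e2] at h
    exact h

end Extremality

/-! ### Operator matrices and the dilation -/

section Dilation

variable {H : Type*} [NormedAddCommGroup H] [InnerProductSpace ℂ H]

/-- The operator with matrix `[[A, B], [C, D]]` on the Hilbert space direct sum `H ⊕ H`. -/
noncomputable def blockOp (A B C D : H →L[ℂ] H) :
    WithLp 2 (H × H) →L[ℂ] WithLp 2 (H × H) :=
  (WithLp.prodContinuousLinearEquiv 2 ℂ H H).symm.toContinuousLinearMap ∘L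
    ((A.coprod B).prod (C.coprod D)) ∘L
    (WithLp.prodContinuousLinearEquiv 2 ℂ H H).toContinuousLinearMap

theorem blockOp_apply (A B C D : H →L[ℂ] H) (x y : H) :
    blockOp A B C D (WithLp.toLp 2 (x, y)) = WithLp.toLp 2 (A x + B y, C x + D y) :=
  rfl

theorem blockOp_mul (A B C D A' B' C' D' : H →L[ℂ] H) :
    blockOp A B C D * blockOp A' B' C' D' =
      blockOp (A * A' + B * C') (A * B' + B * D') (C * A' + D * C') (C * B' + D * D') := by
  refine ContinuousLinearMap.ext fun x => ?_
  obtain ⟨x, y⟩ := x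
  simp only [mul_apply_eq_comp, add_apply, blockOp_apply, map_add, add_add_add_comm]

theorem blockOp_add (A B C D A' B' C' D' : H →L[ℂ] H) :
    blockOp A B C D + blockOp A' B' C' D' = blockOp (A + A') (B + B') (C + C') (D + D') := by
  refine ContinuousLinearMap.ext fun x => ?_
  obtain ⟨x, y⟩ := x
  simp only [add_apply, blockOp_apply, ← WithLp.toLp_add, Prod.mk_add_mk, add_add_add_comm]

theorem blockOp_smul_one (c : ℂ) : blockOp (c • 1) 0 0 (c • 1 : H →L[ℂ] H) = c • 1 := by
  refine ContinuousLinearMap.ext fun x => ?_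
  obtain ⟨x, y⟩ := x
  simp [blockOp_apply, ← WithLp.toLp_smul]

theorem star_blockOp [CompleteSpace H] (A B C D : H →L[ℂ] H) :
    star (blockOp A B C D) = blockOp (star A) (star C) (star B) (star D) := by
  simp only [star_eq_adjoint]
  rw [eq_comm, eq_adjoint_iff]
  intro x y
  simp [blockOp, WithLp.prod_inner_apply, inner_add_left, inner_add_right, adjoint_inner_left]
  abel

/-- The operator matrix `[[t, b], [0, t⁻¹]]`, which is invertible with inverse
`[[t⁻¹, -t⁻¹bt], [0, t]]`. -/
noncomputable def dilationUnit (t : (H →L[ℂ] H)ˣ) (b : H →L[ℂ] H) :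
    (WithLp 2 (H × H) →L[ℂ] WithLp 2 (H × H))ˣ where
  val := blockOp t b 0 (↑t⁻¹ : H →L[ℂ] H)
  inv := blockOp (↑t⁻¹ : H →L[ℂ] H) (-((↑t⁻¹ : H →L[ℂ] H) * b * t)) 0 t
  val_inv := by
    simpa [blockOp_mul, ← mul_assoc] using blockOp_smul_one (H := H) 1
  inv_val := by
    simpa [blockOp_mul, mul_assoc] using blockOp_smul_one (H := H) 1

variable [CompleteSpace H]

theorem isExtremalUnit_dilationUnit {r : ℝ} (t : (H →L[ℂ] H)ˣ) {b : H →L[ℂ] H}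
    (hb : star b = b) (hcomm : Commute b ((t : H →L[ℂ] H) * star (t : H →L[ℂ] H)))
    (hbb : b * b + ((t : H →L[ℂ] H) * star (t : H →L[ℂ] H) +
      star (↑t⁻¹ : H →L[ℂ] H) * (↑t⁻¹ : H →L[ℂ] H)) =
        ((r ^ 2 + r⁻¹ ^ 2 : ℝ) : ℂ) • (1 : H →L[ℂ] H)) :
    IsExtremalUnit r (dilationUnit t b) := by
  change star (blockOp _ _ _ _) * blockOp _ _ _ _ + blockOp _ _ _ _ * star (blockOp _ _ _ _) = _
  have hts : (t : H →L[ℂ] H) * (↑t⁻¹ : H →L[ℂ] H) = 1 := t.mul_inv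
  have hst : (↑t⁻¹ : H →L[ℂ] H) * (t : H →L[ℂ] H) = 1 := t.inv_mul
  generalize (t : H →L[ℂ] H) = T at *
  generalize (↑t⁻¹ : H →L[ℂ] H) = S at *
  have hts' : star T * star S = 1 := by rw [← star_mul, hst, star_one]
  rw [commute_iff_eq] at hcomm
  have e11 : S * b * T * (star T * (b * star S)) =
      ((r ^ 2 + r⁻¹ ^ 2 : ℝ) : ℂ) • (1 : H →L[ℂ] H) - (star T * T + S * star S) := by
    calc S * b * T * (star T * (b * star S)) = S * (b * (T * star T)) * (b * star S) := by
          simp only [mul_assoc]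
      _ = S * T * star T * (b * b) * star S := by rw [hcomm]; simp only [mul_assoc]
      _ = star T * (((r ^ 2 + r⁻¹ ^ 2 : ℝ) : ℂ) • (1 : H →L[ℂ] H) -
            (T * star T + star S * S)) * star S := by
          rw [← hbb, add_sub_cancel_right, hst, one_mul]
      _ = ((r ^ 2 + r⁻¹ ^ 2 : ℝ) : ℂ) • (star T * star S) -
            (star T * T * (star T * star S) + star T * star S * S * star S) := by
          simp only [mul_sub, sub_mul, mul_add, add_mul, mul_smul_comm, smul_mul_assoc, mul_one,
            mul_assoc]
      _ = _ := by rw [hts', mul_one, one_mul]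
  have e12 : S * b * T * star T = star T * b := by
    rw [mul_assoc, mul_assoc, hcomm, mul_assoc, ← mul_assoc S, hst, one_mul]
  have e21 : T * (star T * (b * star S)) = b * T := by
    rw [← mul_assoc, ← mul_assoc, ← hcomm, mul_assoc, mul_assoc, hts', mul_one]
  rw [star_blockOp, star_blockOp, blockOp_mul, blockOp_mul, blockOp_add, ← blockOp_smul_one]
  simp only [star_neg, star_mul, star_zero, mul_zero, zero_mul, add_zero, zero_add, hb, neg_mul,
    mul_neg, neg_neg, e11, e12, e21, add_neg_cancel]
  congr 1
  · abel
  · rw [← hbb]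
    abel

/-- The operator `b` is the positive square root of `r² + r⁻² - tt* - (tt*)⁻¹`. -/
theorem exists_isExtremalUnit_dilationUnit {r : ℝ} (hr0 : 0 < r) (t : (H →L[ℂ] H)ˣ)
    (h1 : ‖(t : H →L[ℂ] H)‖ ≤ r⁻¹) (h2 : ‖(↑t⁻¹ : H →L[ℂ] H)‖ ≤ r⁻¹) :
    ∃ b : H →L[ℂ] H, IsExtremalUnit r (dilationUnit t b) := by
  have h := star_mul_self_add_inv_le hr0 (star t) (by simpa using h1)
    (by rwa [← star_inv, Units.coe_star, norm_star])
  have hXY := star_mul_self_mul_inv_mul_star (star t)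
  have hYX := inv_mul_star_mul_star_mul_self (star t)
  rw [← star_inv, Units.coe_star, Units.coe_star, star_star, star_star] at h hXY hYX
  rw [← sub_nonneg] at h
  have hc : Commute (((r ^ 2 + r⁻¹ ^ 2 : ℝ) : ℂ) • (1 : H →L[ℂ] H) -
      ((t : H →L[ℂ] H) * star (t : H →L[ℂ] H) +
        star (↑t⁻¹ : H →L[ℂ] H) * (↑t⁻¹ : H →L[ℂ] H)))
      ((t : H →L[ℂ] H) * star (t : H →L[ℂ] H)) :=
    ((Commute.one_left _).smul_left _).sub_left
      ((Commute.refl _).add_left (hYX.trans hXY.symm))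
  refine ⟨CFC.sqrt _, isExtremalUnit_dilationUnit t (CFC.sqrt_nonneg _).isSelfAdjoint.star_eq ?_
    (eq_sub_iff_add_eq.1 (CFC.sqrt_mul_sqrt_self _ h))⟩
  rw [CFC.sqrt_eq_cfc]
  exact hc.cfc_nnreal _

/-- The inclusion of the first summand of `H ⊕ H`. -/
noncomputable def inlIsometry (H : Type*) [NormedAddCommGroup H] [InnerProductSpace ℂ H] :
    H →ₗᵢ[ℂ] WithLp 2 (H × H) where
  toLinearMap := (WithLp.linearEquiv 2 ℂ (H × H)).symm.toLinearMap ∘ₗ LinearMap.inl ℂ H H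
  norm_map' x := WithLp.norm_toLp_fst 2 H H x

/-- If `V t = j V`, the range of `V` is invariant under all powers of `j`, which restrict there to
those of `t`. -/
theorem dilatesVia_of_intertwines {K : Type*} [NormedAddCommGroup K] [InnerProductSpace ℂ K]
    [CompleteSpace K] (t : (H →L[ℂ] H)ˣ) (j : (K →L[ℂ] K)ˣ) (V : H →ₗᵢ[ℂ] K)
    (hV : ∀ x, (j : K →L[ℂ] K) (V x) = V ((t : H →L[ℂ] H) x)) :
    DilatesVia (t : H →L[ℂ] H) (j : K →L[ℂ] K) V := by
  have hinv (x : H) : (↑j⁻¹ : K →L[ℂ] K) (V x) = V ((↑t⁻¹ : H →L[ℂ] H) x) := by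
    have e1 : (t : H →L[ℂ] H) ((↑t⁻¹ : H →L[ℂ] H) x) = x := by
      rw [← mul_apply_eq_comp, t.mul_inv, one_apply_eq_self]
    have e2 (y : K) : (↑j⁻¹ : K →L[ℂ] K) ((j : K →L[ℂ] K) y) = y := by
      rw [← mul_apply_eq_comp, j.inv_mul, one_apply_eq_self]
    rw [← e2 (V ((↑t⁻¹ : H →L[ℂ] H) x)), hV, e1]
  have hpow (n : ℤ) : ∀ x, (↑(j ^ n) : K →L[ℂ] K) (V x) = V ((↑(t ^ n) : H →L[ℂ] H) x) := by
    induction n with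
    | zero => simp
    | succ n ih =>
      intro x
      rw [zpow_add_one, zpow_add_one, Units.val_mul, Units.val_mul, mul_apply_eq_comp,
        mul_apply_eq_comp, hV, ih]
    | pred n ih =>
      intro x
      rw [zpow_sub_one, zpow_sub_one, Units.val_mul, Units.val_mul, mul_apply_eq_comp,
        mul_apply_eq_comp, hinv, ih]
  refine ⟨t, j, rfl, rfl, fun n => ContinuousLinearMap.ext fun x => ext_inner_left ℂ fun y => ?_⟩
  simp [adjoint_inner_right, hpow]

end Dilation

theorem theorem1p1 (r : ℝ) (hr0 : 0 < r) (hr1 : r < 1) :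
    (∀ (H : Type u) [NormedAddCommGroup H] [InnerProductSpace ℂ H] [CompleteSpace H]
      (J : H →L[ℂ] H), QABoundary r J →
        QuantumAnnulus r J ∧ DilationExtremal.{u, v} r J) ∧
    (∀ (K : Type u) [NormedAddCommGroup K] [InnerProductSpace ℂ K] [CompleteSpace K]
      (E : Type v) [NormedAddCommGroup E] [InnerProductSpace ℂ E] [CompleteSpace E]
      (J : K →L[ℂ] K) (π : (K →L[ℂ] K) →⋆ₐ[ℂ] (E →L[ℂ] E)),
        QABoundary r J → QABoundary r (π J)) ∧
    (∀ (H : Type u) [NormedAddCommGroup H] [InnerProductSpace ℂ H] [CompleteSpace H]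
      (T : H →L[ℂ] H), QuantumAnnulus r T →
        ∃ (K : Type u) (_ : NormedAddCommGroup K) (_ : InnerProductSpace ℂ K)
          (_ : CompleteSpace K) (J : K →L[ℂ] K) (V : H →ₗᵢ[ℂ] K),
          QABoundary r J ∧ DilatesVia T J V) := by
  refine ⟨?_, ?_, ?_⟩
  · intro H _ _ _ J hJ
    obtain ⟨j, rfl, h1, h2, hj⟩ := hJ.exists_isExtremalUnit hr0 hr1.le
    have hQ : QuantumAnnulus r (j : H →L[ℂ] H) := ⟨j, rfl, h1, h2⟩
    refine ⟨hQ, hQ, ?_⟩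
    intro K _ _ _ F V hF hV
    exact hj.reduces hr0 hF hV
  · intro K _ _ _ E _ _ _ J π hJ
    obtain ⟨j, rfl, -, -, hj⟩ := hJ.exists_isExtremalUnit hr0 hr1.le
    exact (hj.map π).qaBoundary hr0
  · rintro H _ _ _ _ ⟨t, rfl, h1, h2⟩
    obtain ⟨b, hb⟩ := exists_isExtremalUnit_dilationUnit hr0 t h1 h2
    refine ⟨WithLp 2 (H × H), inferInstance, inferInstance, inferInstance, dilationUnit t b,
      inlIsometry H, hb.qaBoundary hr0, dilatesVia_of_intertwines _ _ _ fun x => ?_⟩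
    change blockOp _ _ _ _ (WithLp.toLp 2 (x, 0)) = WithLp.toLp 2 (_, 0)
    simp [blockOp_apply]
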